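/- An edge-ordered graph is a finite graph, with at least one vertex, equipped with a total order of its edge set; $|G|$ denotes its number of vertices and $\delta(G)$ its minimum degree. A copy of an edge-ordered graph $F$ in an edge-ordered graph $G$ is a (not necessarily induced) subgraph $F'$ of $G$ for which there is a graph isomorphism from $F$ to $F'$ carrying the total order of $E(F)$ to the total order of $E(F')$ inherited from $E(G)$. A perfect $F$-tiling in $G$ is a collection of vertex-disjoint copies of $F$ in $G$ that together cover all vertices of $G$. Call $F$ tileable if there is a positive integer $t$ divisible by $|F|$ such that every edge-ordering of the complete graph $K_t$ contains a perfect $F$-tiling, and in this case let $T(F)$ be the smallest such $t$. **Theorem.** Let $F$ be a tileable edge-ordered graph. For every integer $n\ge T(F)$ divisible by $|F|$, every edge-ordered graph $G$ on $n$ vertices with $$\delta(G)\ \ge\ \Bigl(1-\frac{1}{T(F)}\Bigr)n$$ contains a perfect $F$-tiling. -/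

import Mathlib

/-- An edge-ordered graph on the vertex set `V`: a graph together with a total order of its
edge set. -/
structure EdgeOrderedGraph (V : Type*) where
  /-- The underlying graph. -/
  graph : SimpleGraph V
  /-- The total order of the edges. -/
  edgeOrder : LinearOrder graph.edgeSet

namespace EdgeOrderedGraph

/-- An injective homomorphism `φ` of the underlying graphs preserves the edge orders: if `e < e'`
in `F`, then the image of `e` is smaller than the image of `e'` in `G`. -/
def PreservesEdgeOrder {W V : Type*} (F : EdgeOrderedGraph W) (G : EdgeOrderedGraph V)
    (φ : SimpleGraph.Copy F.graph G.graph) : Prop :=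
  ∀ e e' : F.graph.edgeSet, F.edgeOrder.lt e e' →
    G.edgeOrder.lt (φ.toHom.mapEdgeSet e) (φ.toHom.mapEdgeSet e')

/-- The subgraph `H` of `G` is a copy of `F` in `G`: it is the image of `F` under an injective
homomorphism that preserves the edge orders, where the edges of `H` are ordered as in `G`. -/
def IsCopy {W V : Type*} (F : EdgeOrderedGraph W) (G : EdgeOrderedGraph V)
    (H : G.graph.Subgraph) : Prop :=
  ∃ φ : SimpleGraph.Copy F.graph G.graph, PreservesEdgeOrder F G φ ∧ φ.toSubgraph = H

/-- An `F`-tiling in `G`: a collection of vertex-disjoint copies of `F` in `G`. -/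
def IsTiling {W V : Type*} (F : EdgeOrderedGraph W) (G : EdgeOrderedGraph V)
    (𝒯 : Set G.graph.Subgraph) : Prop :=
  (∀ H ∈ 𝒯, IsCopy F G H) ∧ 𝒯.PairwiseDisjoint SimpleGraph.Subgraph.verts

/-- `G` contains a perfect `F`-tiling, that is, an `F`-tiling that covers all vertices of `G`. -/
def HasPerfectTiling {W V : Type*} (F : EdgeOrderedGraph W) (G : EdgeOrderedGraph V) : Prop :=
  ∃ 𝒯 : Set G.graph.Subgraph, IsTiling F G 𝒯 ∧ ∀ v : V, ∃ H ∈ 𝒯, v ∈ H.verts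

/-- The positive integers `t`, divisible by the number of vertices of `F`, such that every
edge-ordering of the complete graph `K_t` contains a perfect `F`-tiling. -/
def tilingOrders {W : Type*} [Fintype W] (F : EdgeOrderedGraph W) : Set ℕ :=
  {t | 0 < t ∧ Fintype.card W ∣ t ∧
    ∀ K : EdgeOrderedGraph (Fin t), K.graph = ⊤ → HasPerfectTiling F K}

/-- `F` is tileable if for some positive integer `t` divisible by `|F|`, every edge-ordering of
`K_t` contains a perfect `F`-tiling. -/
def Tileable {W : Type*} [Fintype W] (F : EdgeOrderedGraph W) : Prop :=
  (tilingOrders F).Nonempty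

/-- For a tileable `F`, the smallest `t` as in the definition of tileability. -/
noncomputable def tilingNumber {W : Type*} [Fintype W] (F : EdgeOrderedGraph W) : ℕ :=
  sInf (tilingOrders F)

end EdgeOrderedGraph

/-!
Let `t = T(F)` and `k = ⌊n / t⌋`. The degree condition says that the complement of `G` has maximum
degree less than `k`, so the Hajnal–Szemerédi theorem, applied to the complement, splits any `k * t`
vertices into `k` cliques of order `t` in `G`, each of which has a perfect `F`-tiling. As `|F|`
divides `n - k * t`, we can remove copies of `F` found in this way one at a time until exactly
`k * t` vertices are left, and then tile all `k` cliques.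

The Hajnal–Szemerédi theorem is proved as by Kierstead and Kostochka, by induction on the number of
edges. Delete the edges at a vertex, colour the rest equitably and recolour that vertex: some class
`a` is now one vertex short and some class `b` has one too many. Let `A` be the set of classes from
which a vertex can be passed on, class by class, to `a`. If `b ∈ A`, shift a vertex from `b` to `a`.
Otherwise a weighting argument finds a vertex `z` in a class of `A` and a vertex `y` outside `A`
whose only neighbour in the class of `z` is `z`, such that exchanging `y` for `z` either lets `A`
absorb `y` or enlarges `A`. The classes outside `A` are recoloured by the induction hypothesis.
-/

namespace HajnalSzemeredi

open Finset Relation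
open scoped Classical

section Reachability

variable {κ : Type*} {r : κ → κ → Prop} {D D' : Finset κ} {a x W : κ}

/-- There is a directed path from `x` to `a` in the restriction of the digraph `r` to `D`. The
trivial path from `a` to `a` is allowed even if `a ∉ D`. -/
def ReachIn (r : κ → κ → Prop) (D : Finset κ) : κ → κ → Prop :=
  ReflTransGen fun x y => r x y ∧ x ∈ D ∧ y ∈ D

theorem ReachIn.mono (h : ReachIn r D x a) (hD : D ⊆ D') : ReachIn r D' x a :=
  ReflTransGen.mono (fun _ _ hxy => ⟨hxy.1, hD hxy.2.1, hD hxy.2.2⟩) _ _ h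

theorem ReachIn.eq_of_notMem_left (h : ReachIn r D x a) (hx : x ∉ D) : x = a := by
  obtain rfl | ⟨y, hxy, -⟩ := ReflTransGen.cases_head h
  exacts [rfl, absurd hxy.2.1 hx]

theorem ReachIn.eq_of_notMem_right (h : ReachIn r D x a) (ha : a ∉ D) : x = a := by
  obtain rfl | ⟨y, -, hya⟩ := ReflTransGen.cases_tail h
  exacts [rfl, absurd hya.2.2 ha]

theorem ReachIn.erase_of_not (h : ReachIn r D x a) (hW : ¬ReachIn r D W a) :
    ReachIn r (D.erase W) x a := by
  induction h using ReflTransGen.head_induction_on with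
  | refl => exact .refl
  | head hxy hya ih =>
    have ne_W : ∀ {z}, ReachIn r D z a → z ≠ W := by
      rintro _ hz rfl
      exact hW hz
    exact .head ⟨hxy.1, mem_erase.2 ⟨ne_W (.head hxy hya), hxy.2.1⟩,
      mem_erase.2 ⟨ne_W hya, hxy.2.2⟩⟩ ih

theorem ReachIn.erase_or (h : ReachIn r D x a) (U : κ) :
    ReachIn r (D.erase U) x a ∨ U = a ∨
      ∃ y ∈ D.erase U, r U y ∧ ReachIn r (D.erase U) y a := by
  induction h using ReflTransGen.head_induction_on with
  | refl => exact .inl .refl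
  | @head x y hxy _ ih =>
    obtain hy | h := ih
    · by_cases hyU : y = U
      · subst hyU
        exact .inr (.inl (hy.eq_of_notMem_left (notMem_erase _ _)))
      have hyD : y ∈ D.erase U := mem_erase.2 ⟨hyU, hxy.2.2⟩
      by_cases hxU : x = U
      · subst hxU
        exact .inr (.inr ⟨y, hyD, hxy.1, hy⟩)
      · exact .inl (.head ⟨hxy.1, mem_erase.2 ⟨hxU, hxy.2.1⟩, hyD⟩ hy)
    · exact .inr h

theorem ReachIn.exists_step (h : ReachIn r D x a) (hxa : x ≠ a) :
    ∃ y ∈ D.erase x, r x y ∧ ReachIn r (D.erase x) y a := by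
  obtain h | h | h := h.erase_or x
  · exact absurd (h.eq_of_notMem_left (notMem_erase x D)) hxa
  · exact absurd h hxa
  · exact h

theorem ReachIn.erase_of_not_erase {U : κ} (hU : ReachIn r D U a) (hUD : U ∈ D)
    (hWU : W ≠ U) (hW : ¬ReachIn r (D.erase U) W a) : ReachIn r (D.erase W) U a := by
  obtain rfl | hUa := eq_or_ne U a
  · exact .refl
  obtain ⟨y, hyD, hUy, hy⟩ := hU.exists_step hUa
  have hyW : y ≠ W := by
    rintro rfl
    exact hW hy
  exact .head ⟨hUy, mem_erase.2 ⟨hWU.symm, hUD⟩, mem_erase.2 ⟨hyW, mem_of_mem_erase hyD⟩⟩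
    ((hy.erase_of_not hW).mono (erase_subset_erase _ (erase_subset _ _)))

theorem exists_terminal_block {A : Finset κ} (hA : ∀ x ∈ A, ReachIn r A x a) (ha : a ∈ A)
    (hne : ∃ x ∈ A, x ≠ a) :
    ∃ U, ∃ T ⊆ A, T.Nonempty ∧ a ∉ T ∧
      (∀ W ∈ T, ∀ x ∈ A.erase W, ReachIn r (A.erase W) x a) ∧
      ∀ W ∈ T, ∀ X ∈ A, X ∉ T → X ≠ U → ¬r W X := by
  let cut (U : κ) : Finset κ := {x ∈ A.erase U | ¬ReachIn r (A.erase U) x a}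
  have mem_cut {U x : κ} : x ∈ cut U ↔ (x ≠ U ∧ x ∈ A) ∧ ¬ReachIn r (A.erase U) x a := by
    rw [mem_filter, mem_erase]
  have ha_cut : (cut a).Nonempty := by
    obtain ⟨x, hx, hxa⟩ := hne
    exact ⟨x, mem_cut.2 ⟨⟨hxa, hx⟩, fun h => hxa (h.eq_of_notMem_right (notMem_erase a A))⟩⟩
  obtain ⟨U, hU, hmin⟩ := exists_min_image {U ∈ A | (cut U).Nonempty} (fun U => #(cut U))
    ⟨a, mem_filter.2 ⟨ha, ha_cut⟩⟩
  obtain ⟨hUA, hUne⟩ := mem_filter.1 hU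
  refine ⟨U, cut U, fun x hx => (mem_cut.1 hx).1.2, hUne,
    fun h => (mem_cut.1 h).2 .refl, fun W hW => ?_, fun W hW X hX hXT hXU hr => ?_⟩
  · obtain ⟨⟨hWU, hWA⟩, hWreach⟩ := mem_cut.1 hW
    have hsub : cut W ⊆ cut U := fun x hx => by
      obtain ⟨⟨-, hxA⟩, hx⟩ := mem_cut.1 hx
      refine mem_cut.2 ⟨⟨?_, hxA⟩, fun h => hx ?_⟩
      · rintro rfl
        exact hx ((hA x hxA).erase_of_not_erase hxA hWU hWreach)
      · exact (h.erase_of_not hWreach).mono (erase_subset_erase _ (erase_subset _ _))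
    have hssub : cut W ⊂ cut U :=
      hsub.ssubset_of_mem_notMem hW fun h => (mem_cut.1 h).1.1 rfl
    by_contra! h
    obtain ⟨x, hx, hxW⟩ := h
    exact (card_lt_card hssub).not_ge
      (hmin W (mem_filter.2 ⟨hWA, x, mem_filter.2 ⟨hx, hxW⟩⟩))
  · have hXU' : X ∈ A.erase U := mem_erase.2 ⟨hXU, hX⟩
    have hXreach : ReachIn r (A.erase U) X a := by
      by_contra h
      exact hXT (mem_filter.2 ⟨hXU', h⟩)
    obtain ⟨hWU, hWreach⟩ := mem_cut.1 hW
    exact hWreach (.head ⟨hr, mem_erase.2 hWU, hXU'⟩ hXreach)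

end Reachability

section Recoloring

variable {V κ : Type*} {G H : SimpleGraph V} {c : V → κ} {v w : V} {i j : κ}

/-- `c` is a proper colouring of `G`. Colourings are plain functions rather than terms of
`G.Coloring κ`, so that one function can be proper for several graphs on `V`. -/
def IsProper (G : SimpleGraph V) (c : V → κ) : Prop :=
  ∀ ⦃v w⦄, G.Adj v w → c v ≠ c w

/-- The colour `j` does not occur among the neighbours of `v`. -/
def IsFree (G : SimpleGraph V) (c : V → κ) (v : V) (j : κ) : Prop :=
  ∀ w, G.Adj v w → c w ≠ j

/-- The digraph on the colours, with an arc from `i` to `j` if some vertex of colour `i` can be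
recoloured with `j`. -/
def Moves (G : SimpleGraph V) (c : V → κ) (i j : κ) : Prop :=
  ∃ v, c v = i ∧ IsFree G c v j

theorem IsProper.mono (hc : IsProper G c) (h : H ≤ G) : IsProper H c :=
  fun _ _ hvw => hc (h hvw)

theorem IsProper.update (hc : IsProper (G.deleteIncidenceSet v) c) (hj : IsFree G c v j) :
    IsProper G (Function.update c v j) := by
  intro x y hxy
  by_cases hx : x = v <;> by_cases hy : y = v
  · exact absurd (hx.trans hy.symm) hxy.ne
  · subst hx
    simpa [hy] using (hj y hxy).symm
  · subst hy
    simpa [hx] using hj x hxy.symm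
  · simpa [hx, hy] using hc (G.deleteIncidenceSet_adj.2 ⟨hxy, hx, hy⟩)

theorem Moves.update {k : κ} (h : Moves G c i k) (hvi : c v ≠ i) (hjk : j ≠ k) :
    Moves G (Function.update c v j) i k := by
  obtain ⟨x, hx, hfree⟩ := h
  have hxv : x ≠ v := by
    rintro rfl
    exact hvi hx
  refine ⟨x, by simpa [hxv] using hx, fun y hxy => ?_⟩
  obtain rfl | hyv := eq_or_ne y v
  · simpa using hjk
  · simpa [hyv] using hfree y hxy

theorem not_isFree_of_notMem {A : Finset κ} (hA : ∀ ⦃i j⦄, Moves G c i j → j ∈ A → i ∈ A)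
    (hv : c v ∉ A) (hj : j ∈ A) : ¬IsFree G c v j :=
  fun h => hv (hA ⟨v, rfl, h⟩ hj)

theorem exists_isFree {B : Finset κ} {N : Finset V} (hN : ∀ w, G.Adj v w → c w ∈ B → w ∈ N)
    (hcard : #N < #B) : ∃ j ∈ B, IsFree G c v j := by
  obtain ⟨j, hjB, hj⟩ := exists_mem_notMem_of_card_lt_card (card_image_le.trans_lt hcard)
  refine ⟨j, hjB, fun w hvw hwj => hj (mem_image.2 ⟨w, hN w hvw (hwj ▸ hjB), hwj⟩)⟩

variable [Fintype V]

/-- The number of vertices of colour `i`. -/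
noncomputable def classSize (c : V → κ) (i : κ) : ℕ := #{v | c v = i}

theorem classSize_update (c : V → κ) (v : V) (j : κ) :
    classSize (Function.update c v j) + Pi.single (c v) 1 = classSize c + Pi.single j 1 := by
  have hcount (c : V → κ) (i : κ) :
      classSize c i = #{w ∈ univ.erase v | c w = i} + (Pi.single (c v) 1 : κ → ℕ) i := by
    rw [classSize, card_filter, ← sum_erase_add _ _ (mem_univ v), ← card_filter, Pi.single_apply]
    simp only [eq_comm]
  have herase (i : κ) : {w ∈ univ.erase v | Function.update c v j w = i} =
      {w ∈ univ.erase v | c w = i} :=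
    filter_congr fun w hw => by rw [Function.update_of_ne (ne_of_mem_erase hw)]
  funext i
  simp only [Pi.add_apply, hcount, herase, Function.update_self]
  omega

/-- Recolouring one vertex on each arc of a path from `i` to `a` moves a vertex from the class `i`
to the class `a`. The relation `r` is a part of `Moves G c` that survives these changes: it
ignores the arcs into the start of the path. -/
theorem IsProper.exists_shift {r : κ → κ → Prop} {D : Finset κ} {a : κ} (hc : IsProper G c)
    (hr : ∀ x ∈ D, ∀ y ∈ D, y ≠ i → r x y → Moves G c x y) (hi : i ∈ D) (h : ReachIn r D i a) :
    ∃ c' : V → κ, IsProper G c' ∧ classSize c' + Pi.single i 1 = classSize c + Pi.single a 1 ∧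
      (∀ v, c v ∉ D → c' v = c v) ∧ ∀ v, c v ∈ D → c' v ∈ D := by
  induction D using Finset.strongInduction generalizing c i with
  | H D ih =>
    obtain rfl | hia := eq_or_ne i a
    · exact ⟨c, hc, rfl, fun _ _ => rfl, fun _ => id⟩
    obtain ⟨k, hk, hik, hka⟩ := h.exists_step hia
    obtain ⟨hki, hkD⟩ := mem_erase.1 hk
    obtain ⟨v, rfl, hfree⟩ := hr i hi k hkD hki hik
    have hr' : ∀ x ∈ D.erase (c v), ∀ y ∈ D.erase (c v), y ≠ k → r x y →
        Moves G (Function.update c v k) x y := fun x hx y hy hyk hxy =>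
      (hr x (mem_of_mem_erase hx) y (mem_of_mem_erase hy) (ne_of_mem_erase hy) hxy).update
        (ne_of_mem_erase hx).symm hyk.symm
    obtain ⟨c', hc', hsize, hout, hin⟩ := ih _ (erase_ssubset hi)
      ((hc.mono (G.deleteIncidenceSet_le v)).update hfree) hr' hk hka
    refine ⟨c', hc', ?_, fun w hw => ?_, fun w hw => ?_⟩
    · have := classSize_update c v k
      funext l
      have h₁ := congrFun hsize l
      have h₂ := congrFun this l
      simp only [Pi.add_apply] at h₁ h₂ ⊢
      omega
    · have hwv : w ≠ v := by
        rintro rfl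
        exact hw hi
      have hupd : Function.update c v k w = c w := Function.update_of_ne hwv _ _
      rw [hout w (by rw [hupd]; exact fun h => hw (mem_of_mem_erase h)), hupd]
    · obtain rfl | hwv := eq_or_ne w v
      · exact mem_of_mem_erase (hin w (by simpa using hk))
      have hupd : Function.update c v k w = c w := Function.update_of_ne hwv _ _
      by_cases hcw : c w = c v
      · rw [hout w (by simp [hupd, hcw]), hupd]
        exact hw
      · exact mem_of_mem_erase (hin w (by rw [hupd]; exact mem_erase.2 ⟨hcw, hw⟩))

end Recoloring

section Accessible

variable {V κ : Type*} [Fintype κ] {G : SimpleGraph V} {c : V → κ} {a : κ}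

/-- The colours from which a path of `Moves G c` leads to the colour `a`. -/
noncomputable def accessible (G : SimpleGraph V) (c : V → κ) (a : κ) : Finset κ :=
  {i | ReflTransGen (Moves G c) i a}

theorem mem_accessible_self (G : SimpleGraph V) (c : V → κ) (a : κ) : a ∈ accessible G c a := by
  simpa [accessible] using ReflTransGen.refl

theorem mem_accessible_of_moves {i j : κ} (hij : Moves G c i j) (hj : j ∈ accessible G c a) :
    i ∈ accessible G c a := by
  simp only [accessible, mem_filter, mem_univ, true_and] at hj ⊢
  exact .head hij hj

theorem reachIn_accessible {i : κ} (hi : i ∈ accessible G c a) :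
    ReachIn (Moves G c) (accessible G c a) i a := by
  have h : ReflTransGen (Moves G c) i a := by simpa [accessible] using hi
  clear hi
  induction h using ReflTransGen.head_induction_on with
  | refl => exact .refl
  | head hij hja ih =>
    have hj : _ ∈ accessible G c a := (mem_filter_univ _).2 hja
    exact .head ⟨hij, mem_accessible_of_moves hij hj, hj⟩ ih

theorem subset_accessible {c' : V → κ} {D : Finset κ}
    (hD : ∀ i ∈ D, ReachIn (Moves G c) D i a)
    (hmoves : ∀ i ∈ D, ∀ j ∈ D, Moves G c i j → Moves G c' i j) :
    D ⊆ accessible G c' a := fun i hi =>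
  (mem_filter_univ _).2 <| ReflTransGen.mono (fun i j hij => hmoves i hij.2.1 j hij.2.2 hij.1) _ _
    (hD i hi)

end Accessible

section Counting

variable {V κ : Type*} [Fintype V] {G : SimpleGraph V} {c : V → κ} {A T : Finset κ}
  {U W a : κ} {s : ℕ} {v x y z : V}

theorem card_filter_mem (c : V → κ) (T : Finset κ) : #{v | c v ∈ T} = ∑ i ∈ T, classSize c i := by
  rw [card_eq_sum_card_fiberwise (f := c) (t := T) fun v hv => by simpa using hv]
  refine sum_congr rfl fun i hi => congrArg card ?_
  ext v
  simp only [mem_filter, mem_univ, true_and, and_iff_right_iff_imp]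
  rintro rfl
  exact hi

/-- The number of neighbours of `v` of colour `i`. -/
noncomputable def colDeg (G : SimpleGraph V) (c : V → κ) (v : V) (i : κ) : ℕ :=
  #{w | G.Adj v w ∧ c w = i}

/-- The number of neighbours of `v` whose colour does not lie in `A`. -/
noncomputable def outDeg (G : SimpleGraph V) (c : V → κ) (A : Finset κ) (v : V) : ℕ :=
  #{w | G.Adj v w ∧ c w ∉ A}

/-- `z` is solo for `y`: it is the only neighbour of `y` in the class of `z`, and the colour of `y`
is not in `A`. -/
def IsSolo (G : SimpleGraph V) (c : V → κ) (A : Finset κ) (z y : V) : Prop :=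
  c y ∉ A ∧ G.Adj y z ∧ ∀ w, G.Adj y w → c w = c z → w = z

/-- The number of vertices for which `z` is solo. -/
noncomputable def soloDeg (G : SimpleGraph V) (c : V → κ) (A : Finset κ) (z : V) : ℕ :=
  #{y | IsSolo G c A z y}

/-- `z` can be recoloured with another colour of `A`. -/
def IsMovable (G : SimpleGraph V) (c : V → κ) (A : Finset κ) (z : V) : Prop :=
  ∃ X ∈ A, X ≠ c z ∧ IsFree G c z X

theorem colDeg_pos (h : ¬IsFree G c v W) : 0 < colDeg G c v W := by
  simp only [IsFree, not_forall, not_not] at h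
  obtain ⟨w, hw, hwW⟩ := h
  exact card_pos.2 ⟨w, by simp [hw, hwW]⟩

theorem sum_colDeg_add_outDeg (G : SimpleGraph V) (c : V → κ) (A : Finset κ) (v : V) :
    ∑ i ∈ A, colDeg G c v i + outDeg G c A v = G.degree v := by
  have hA : ∑ i ∈ A, colDeg G c v i = #{w ∈ G.neighborFinset v | c w ∈ A} := by
    rw [card_eq_sum_card_fiberwise (f := c) (t := A) fun w hw => by simpa using (mem_filter.1 hw).2]
    refine sum_congr rfl fun i hi => congrArg card ?_
    ext w
    simp only [mem_filter, mem_univ, true_and, SimpleGraph.mem_neighborFinset]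
    grind
  have hout : outDeg G c A v = #{w ∈ G.neighborFinset v | c w ∉ A} := by
    rw [outDeg, SimpleGraph.neighborFinset_eq_filter, filter_filter]
  rw [hA, hout, card_filter_add_card_filter_not, SimpleGraph.card_neighborFinset_eq_degree]

theorem sum_outDeg_mul {R : Type*} [CommSemiring R] (X : Finset V) (f : V → R) :
    ∑ x ∈ X, outDeg G c A x * f x = ∑ y with c y ∉ A, ∑ x ∈ X with G.Adj y x, f x := by
  simp only [outDeg, ← nsmul_eq_mul, ← sum_const]
  refine sum_comm' fun x y => ?_
  simp only [mem_filter, mem_univ, true_and, G.adj_comm]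
  tauto

theorem soloDeg_pos (hy : IsSolo G c A z y) : 0 < soloDeg G c A z :=
  card_pos.2 ⟨y, by simpa using hy⟩

theorem soloDeg_le (hy : IsSolo G c A z y)
    (hclique : ∀ y', IsSolo G c A z y' → y' ≠ y → G.Adj y y') :
    soloDeg G c A z ≤ outDeg G c A y + 1 := by
  have hmem : y ∈ ({y | IsSolo G c A z y} : Finset V) := by simpa using hy
  rw [soloDeg, outDeg, ← card_erase_add_one hmem]
  refine Nat.add_le_add_right (card_le_card fun y' hy' => ?_) 1
  obtain ⟨hne, hy'⟩ : y' ≠ y ∧ IsSolo G c A z y' := by simpa using hy'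
  simpa using ⟨hclique y' hy' hne, hy'.1⟩

variable [Fintype κ]

theorem outDeg_add_card_lt {B : Finset κ} (hdeg : G.degree v < Fintype.card κ) (hBA : B ⊆ A)
    (hB : ∀ i ∈ B, ¬IsFree G c v i) : outDeg G c A v + #B < #A + #Aᶜ := by
  have hBsum : #B ≤ ∑ i ∈ A, colDeg G c v i :=
    calc #B = ∑ i ∈ B, 1 := card_eq_sum_ones B
      _ ≤ ∑ i ∈ B, colDeg G c v i := sum_le_sum fun i hi => colDeg_pos (hB i hi)
      _ ≤ ∑ i ∈ A, colDeg G c v i := sum_le_sum_of_subset hBA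
  have := sum_colDeg_add_outDeg G c A v
  rw [card_add_card_compl]
  omega

theorem outDeg_lt (hdeg : G.degree y < Fintype.card κ)
    (hA : ∀ ⦃i j⦄, Moves G c i j → j ∈ A → i ∈ A) (hy : c y ∉ A) : outDeg G c A y < #Aᶜ := by
  have := outDeg_add_card_lt hdeg subset_rfl fun i hi => not_isFree_of_notMem hA hy hi
  omega

theorem outDeg_le_of_not_isMovable (hdeg : G.degree z < Fintype.card κ) (hz : c z ∈ A)
    (hmov : ¬IsMovable G c A z) : outDeg G c A z ≤ #Aᶜ := by
  have := outDeg_add_card_lt hdeg (erase_subset (c z) A) fun i hi hfree =>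
    hmov ⟨i, mem_of_mem_erase hi, ne_of_mem_erase hi, hfree⟩
  have := card_erase_add_one hz
  omega

theorem outDeg_le_of_terminal (hdeg : G.degree x < Fintype.card κ)
    (hT : ∀ X ∈ A, X ∉ T → X ≠ U → ¬Moves G c (c x) X) : outDeg G c A x ≤ #Aᶜ + #T := by
  have hlt : outDeg G c A x + #(A \ insert U T) < #A + #Aᶜ :=
    outDeg_add_card_lt hdeg sdiff_subset fun i hi hfree => by
      rw [mem_sdiff, mem_insert, not_or] at hi
      exact hT i hi.1 hi.2.2 hi.2.1 ⟨x, rfl, hfree⟩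
  have hcard := le_card_sdiff (insert U T) A
  have hinsert := card_insert_le U T
  omega

theorem card_add_outDeg_le_card_solo (hdeg : G.degree y < Fintype.card κ)
    (hA : ∀ ⦃i j⦄, Moves G c i j → j ∈ A → i ∈ A) (hTA : T ⊆ A) (hy : c y ∉ A) :
    #T + outDeg G c A y + 1 ≤ #{z | c z ∈ T ∧ IsSolo G c A z y} + #Aᶜ := by
  have hpos : ∀ i ∈ A, 1 ≤ colDeg G c y i := fun i hi =>
    colDeg_pos (not_isFree_of_notMem hA hy hi)
  have htwo : ∀ i ∈ T, 2 ≤ colDeg G c y i + #{z | c z = i ∧ IsSolo G c A z y} := by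
    intro i hi
    by_contra! hlt
    obtain ⟨z, hz⟩ := card_eq_one.1 (show colDeg G c y i = 1 by have := hpos i (hTA hi); omega)
    have mem_iff : ∀ w, G.Adj y w ∧ c w = i ↔ w = z := fun w => by
      simpa using congrArg (w ∈ ·) hz
    obtain ⟨hyz, hzi⟩ := (mem_iff z).2 rfl
    have hsolo : IsSolo G c A z y :=
      ⟨hy, hyz, fun w hyw hwz => (mem_iff w).1 ⟨hyw, hwz.trans hzi⟩⟩
    have : 0 < #{z | c z = i ∧ IsSolo G c A z y} := card_pos.2 ⟨z, by simp [hzi, hsolo]⟩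
    have := hpos i (hTA hi)
    omega
  have hsolo : #{z | c z ∈ T ∧ IsSolo G c A z y} = ∑ i ∈ T, #{z | c z = i ∧ IsSolo G c A z y} := by
    rw [card_eq_sum_card_fiberwise (f := c) (t := T) fun z hz => (mem_filter.1 hz).2.1]
    refine sum_congr rfl fun i hi => congrArg card ?_
    ext z
    simp only [mem_filter, mem_univ, true_and]
    grind
  have hT : 2 * #T ≤ ∑ i ∈ T, colDeg G c y i + #{z | c z ∈ T ∧ IsSolo G c A z y} := by
    rw [hsolo, ← sum_add_distrib, mul_comm, ← smul_eq_mul]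
    exact card_nsmul_le_sum _ _ _ htwo
  have hAT : #(A \ T) ≤ ∑ i ∈ A \ T, colDeg G c y i := by
    simpa using card_nsmul_le_sum (A \ T) _ 1 fun i hi => hpos i (mem_sdiff.1 hi).1
  have hsum := sum_sdiff (f := colDeg G c y) hTA
  have hcard := card_sdiff_add_card_eq_card hTA
  have htotal := sum_colDeg_add_outDeg G c A y
  have := card_add_card_compl A
  omega

/-- Solo vertices of the class `W` count twice: every vertex outside `A` then sees a weight of at
least `2` in `W`, whereas each vertex of `W` sees at most `q = #Aᶜ` solo, or `2 q` other ones. -/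
theorem exists_isMovable_solo (hdeg : ∀ v, G.degree v < Fintype.card κ)
    (hA : ∀ ⦃i j⦄, Moves G c i j → j ∈ A → i ∈ A) (hTA : T ⊆ A) (hWT : W ∈ T)
    (hT : ∀ X ∈ A, X ∉ T → X ≠ U → ¬Moves G c W X) (hW : classSize c W = s)
    (hB : #Aᶜ * s < #{v | c v ∉ A}) (hcard : #T ≤ #Aᶜ) :
    ∃ z y, c z = W ∧ IsSolo G c A z y ∧ IsMovable G c A z := by
  by_contra! hmov
  let f (x : V) : ℕ := if ∃ y, IsSolo G c A x y then 2 else 1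
  have hf : ∀ x, 1 ≤ f x := fun x => by
    simp only [f]
    split_ifs <;> omega
  have hupper : ∑ x with c x = W, outDeg G c A x * f x ≤ s * (2 * #Aᶜ) := by
    rw [← hW, classSize, ← smul_eq_mul #_]
    refine sum_le_card_nsmul _ _ _ fun x hx => ?_
    obtain rfl : c x = W := by simpa using hx
    simp only [f]
    split_ifs with hsolo
    · obtain ⟨y, hy⟩ := hsolo
      have := outDeg_le_of_not_isMovable (hdeg x) (hTA hWT) (hmov x y rfl hy)
      omega
    · have := outDeg_le_of_terminal (hdeg x) hT
      omega
  have hlower : #{y | c y ∉ A} * 2 ≤ ∑ y with c y ∉ A, ∑ x ∈ {x | c x = W} with G.Adj y x, f x := by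
    rw [← smul_eq_mul]
    refine card_nsmul_le_sum _ _ _ fun y hy => ?_
    have hyA : c y ∉ A := by simpa using hy
    obtain ⟨x, hx⟩ : ∃ x, G.Adj y x ∧ c x = W := by
      simpa [IsFree] using not_isFree_of_notMem hA hyA (hTA hWT)
    have hx_mem : x ∈ ({x | c x = W} : Finset V).filter (G.Adj y) := by simp [hx]
    by_cases hsolo : IsSolo G c A x y
    · have hfx : f x = 2 := if_pos ⟨y, hsolo⟩
      exact hfx ▸ single_le_sum (f := f) (fun _ _ => Nat.zero_le _) hx_mem
    · obtain ⟨w, hyw, hwx, hne⟩ : ∃ w, G.Adj y w ∧ c w = c x ∧ w ≠ x := by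
        simpa [IsSolo, hyA, hx.1] using hsolo
      have hsub : {x, w} ⊆ ({x | c x = W} : Finset V).filter (G.Adj y) := by
        simp [insert_subset_iff, hx, hyw, hwx]
      calc 2 ≤ f x + f w := Nat.add_le_add (hf x) (hf w)
        _ = ∑ x ∈ {x, w}, f x := (sum_pair hne.symm).symm
        _ ≤ _ := sum_le_sum_of_subset hsub
  have hdouble := sum_outDeg_mul (G := G) (c := c) (A := A) {x | c x = W} f
  simp only [Nat.cast_id] at hdouble
  nlinarith

theorem card_le_sum_soloDeg (hdeg : G.degree y < Fintype.card κ)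
    (hA : ∀ ⦃i j⦄, Moves G c i j → j ∈ A → i ∈ A) (hTA : T ⊆ A) (hcard : #Aᶜ < #T)
    (hy : c y ∉ A)
    (hclique : ∀ z, c z ∈ T → IsSolo G c A z y → ∀ y', IsSolo G c A z y' → y' ≠ y → G.Adj y y') :
    (#T : ℚ) ≤ ∑ z with c z ∈ T ∧ IsSolo G c A z y, (#Aᶜ : ℚ) / soloDeg G c A z := by
  have hlt := outDeg_lt hdeg hA hy
  have hsolo := card_add_outDeg_le_card_solo hdeg hA hTA hy
  set m := #{z | c z ∈ T ∧ IsSolo G c A z y}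
  calc (#T : ℚ) ≤ m * (#Aᶜ / (outDeg G c A y + 1 : ℕ)) := by
        rw [← mul_div_assoc, le_div_iff₀ (by positivity)]
        have : #T * (outDeg G c A y + 1) ≤ m * #Aᶜ := by nlinarith
        exact_mod_cast this
    _ ≤ _ := by
        rw [← nsmul_eq_mul]
        refine card_nsmul_le_sum _ _ _ fun z hz => ?_
        obtain ⟨hzT, hzy⟩ := (mem_filter.1 hz).2
        have hpos := soloDeg_pos hzy
        have hle := soloDeg_le hzy (hclique z hzT hzy)
        gcongr

/-- Otherwise every solo vertex is immovable and the vertices for which it is solo are pairwise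
adjacent. Let each `z` in a class of `T` give the weight `#Aᶜ / soloDeg z` to each of the
`soloDeg z` vertices for which it is solo. Then `z` gives at most `#Aᶜ`, but every vertex outside
`A` receives at least `#T`. -/
theorem exists_solo (hdeg : ∀ v, G.degree v < Fintype.card κ)
    (hA : ∀ ⦃i j⦄, Moves G c i j → j ∈ A → i ∈ A) (hTA : T ⊆ A) (hTne : T.Nonempty)
    (hT : ∀ W ∈ T, ∀ X ∈ A, X ∉ T → X ≠ U → ¬Moves G c W X) (hsize : ∀ W ∈ T, classSize c W = s)
    (hB : #Aᶜ * s < #{v | c v ∉ A}) :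
    ∃ z y, c z ∈ T ∧ IsSolo G c A z y ∧
      (IsMovable G c A z ∨ ∃ y', IsSolo G c A z y' ∧ y' ≠ y ∧ ¬G.Adj y y') := by
  by_contra! hcon
  have hcard : #Aᶜ < #T := by
    by_contra! hle
    obtain ⟨W, hW⟩ := hTne
    obtain ⟨z, y, rfl, hsolo, hmov⟩ :=
      exists_isMovable_solo hdeg hA hTA hW (hT W hW) (hsize W hW) hB hle
    exact (hcon z y hW hsolo).1 hmov
  have hgive : ∀ z, ∑ y with IsSolo G c A z y, (#Aᶜ : ℚ) / soloDeg G c A z ≤ #Aᶜ := fun z => by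
    rw [sum_const, nsmul_eq_mul, mul_div_left_comm]
    exact mul_le_of_le_one_right (Nat.cast_nonneg _) (div_self_le_one _)
  have hswap : ∑ y with c y ∉ A, ∑ z with c z ∈ T ∧ IsSolo G c A z y,
      (#Aᶜ : ℚ) / soloDeg G c A z =
      ∑ z with c z ∈ T, ∑ y with IsSolo G c A z y, (#Aᶜ : ℚ) / soloDeg G c A z :=
    sum_comm' fun y z => by
      simp only [mem_filter, mem_univ, true_and]
      exact ⟨fun h => ⟨h.2.2, h.2.1⟩, fun h => ⟨h.1.1, h.2, h.1⟩⟩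
  have hcardT : #{z | c z ∈ T} = #T * s := by
    rw [card_filter_mem, sum_congr rfl hsize, sum_const, smul_eq_mul]
  have hle : #{y | c y ∉ A} * #T ≤ #T * s * #Aᶜ := by
    rw [← hcardT, ← Nat.cast_le (α := ℚ), Nat.cast_mul, Nat.cast_mul, ← nsmul_eq_mul,
      ← nsmul_eq_mul]
    refine (card_nsmul_le_sum _ _ _ fun y hy => ?_).trans
      (hswap.le.trans (sum_le_card_nsmul _ _ _ fun z _ => hgive z))
    exact card_le_sum_soloDeg (hdeg y) hA hTA hcard (mem_filter.1 hy).2 fun z hz hzy =>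
      (hcon z y hz hzy).2
  have := card_pos.2 hTne
  nlinarith

end Counting

section Equitable

variable {V κ : Type*} {G : SimpleGraph V} {c : V → κ} {A : Finset κ} {P : Finset V} {a b : κ}
  {s : ℕ} {v y z : V}

/-- The colouring that follows `g` on `P` and `c` elsewhere, where `g` avoids the colours in `A`. -/
noncomputable def glue (P : Finset V) (g : ↥(P : Set V) → {i // i ∉ A}) (c : V → κ) (v : V) : κ :=
  if h : v ∈ P then g ⟨v, h⟩ else c v

variable {g : ↥(P : Set V) → {i // i ∉ A}}

theorem glue_of_mem (h : v ∈ P) : glue P g c v = g ⟨v, h⟩ :=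
  dif_pos h

theorem glue_of_notMem (h : v ∉ P) : glue P g c v = c v :=
  dif_neg h

theorem isProper_glue (hc : IsProper G c) (hg : IsProper (G.induce (P : Set V)) g)
    (hP : ∀ v, v ∉ P → c v ∈ A) : IsProper G (glue P g c) := by
  intro v w hvw
  by_cases hv : v ∈ P <;> by_cases hw : w ∈ P
  · rw [glue_of_mem hv, glue_of_mem hw, ne_eq, Subtype.coe_inj]
    exact hg (v := ⟨v, hv⟩) (w := ⟨w, hw⟩) hvw
  · rw [glue_of_mem hv, glue_of_notMem hw]
    exact fun h => (g ⟨v, hv⟩).2 (h ▸ hP w hw)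
  · rw [glue_of_notMem hv, glue_of_mem hw]
    exact fun h => (g ⟨w, hw⟩).2 (h ▸ hP v hv)
  · rw [glue_of_notMem hv, glue_of_notMem hw]
    exact hc hvw

variable [Fintype V]

/-- `G` has a proper colouring with colours `κ` that uses every colour exactly `s` times. -/
def HasEquitableColoring (G : SimpleGraph V) (κ : Type*) (s : ℕ) : Prop :=
  ∃ c : V → κ, IsProper G c ∧ ∀ i, classSize c i = s

/-- All classes of `c` have size `s`, except that the class `a` misses a vertex and the class `b`
has an additional one. For `a = b` all classes have size `s`. -/
def NearlyEquitable (c : V → κ) (s : ℕ) (a b : κ) : Prop :=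
  classSize c + Pi.single a 1 = (fun _ => s) + Pi.single b 1

theorem NearlyEquitable.classSize_eq_of_ne {i : κ} (h : NearlyEquitable c s a b) (ha : i ≠ a)
    (hb : i ≠ b) : classSize c i = s := by
  simpa [ha, hb] using congrFun h i

theorem NearlyEquitable.card_filter_notMem [Fintype κ] (h : NearlyEquitable c s a b) (ha : a ∈ A)
    (hb : b ∉ A) : #{v | c v ∉ A} = #Aᶜ * s + 1 := by
  have hsum : ∑ i ∈ Aᶜ, (classSize c i + (Pi.single a 1 : κ → ℕ) i) =
      ∑ i ∈ Aᶜ, (s + (Pi.single b 1 : κ → ℕ) i) := sum_congr rfl fun i _ => congrFun h i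
  simpa [sum_add_distrib, ← card_filter_mem, sum_pi_single', ha, hb] using hsum

theorem classSize_glue_of_mem (hP : ∀ v ∈ P, c v ∉ A) {i : κ} (hi : i ∈ A) :
    classSize (glue P g c) i = classSize c i := by
  refine congrArg card (filter_congr fun v _ => ?_)
  by_cases hv : v ∈ P
  · rw [glue_of_mem hv]
    exact iff_of_false (fun h => (g ⟨v, hv⟩).2 (h ▸ hi)) fun h => hP v hv (h ▸ hi)
  · rw [glue_of_notMem hv]

theorem classSize_glue_of_notMem (hP : ∀ v, v ∉ P → c v ∈ A) {i : κ} (hi : i ∉ A) :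
    classSize (glue P g c) i = classSize g ⟨i, hi⟩ := by
  have himage : ({v | glue P g c v = i} : Finset V) =
      ({v | g v = ⟨i, hi⟩} : Finset (P : Set V)).map (.subtype _) := by
    ext v
    simp only [mem_filter, mem_univ, true_and, mem_map, Function.Embedding.coe_subtype]
    by_cases hv : v ∈ P
    · simp [glue_of_mem hv, hv, Subtype.ext_iff]
    · rw [glue_of_notMem hv]
      refine iff_of_false (fun h => hi (h ▸ hP v hv)) ?_
      rintro ⟨v, -, rfl⟩
      exact hv v.2
  rw [classSize, himage, card_map, classSize]
  congr!

/-- If `z` is solo for `y` and can move to `X`, shift a vertex from `X` to `a` inside the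
other classes of `A` and let `y` take the place of `z`. -/
theorem IsProper.exists_absorb {X : κ} (hc : IsProper G c) (hne : NearlyEquitable c s a b)
    (hb : b ∉ A) (hz : c z ∈ A) (hy : IsSolo G c A z y) (hX : X ∈ A) (hXz : X ≠ c z)
    (hfree : IsFree G c z X) (hreach : ReachIn (Moves G c) (A.erase (c z)) X a) :
    ∃ c' : V → κ, IsProper G c' ∧ (∀ i ∈ A, classSize c' i = s) ∧
      ∀ v, c' v ∉ A ↔ c v ∉ A ∧ v ≠ y := by
  obtain ⟨hyA, hyz, hsolo⟩ := hy
  have hXD : X ∈ A.erase (c z) := mem_erase.2 ⟨hXz, hX⟩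
  set c₁ := Function.update c z X
  have c₁_of_ne : ∀ v, v ≠ z → c₁ v = c v := fun v hv => Function.update_of_ne hv _ _
  have c₁_z : c₁ z = X := Function.update_self ..
  obtain ⟨c₂, hc₂, hsize₂, hout, hin⟩ := IsProper.exists_shift (r := Moves G c)
    ((hc.mono (G.deleteIncidenceSet_le z)).update hfree)
    (fun i hi j _ hj hij => hij.update (ne_of_mem_erase hi).symm hj.symm) hXD hreach
  have c₂_mem : ∀ v, c₂ v ∈ A ↔ c v ∈ A := fun v => by
    grind
  have c₂_y : c₂ y = c y := by grind [hyz.ne]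
  have hfree₂ : IsFree G c₂ y (c z) := fun w hyw hwz => by
    have hw : c₁ w ∉ A.erase (c z) := fun h => ne_of_mem_erase (hin w h) hwz
    have hwz' : w ≠ z := by
      rintro rfl
      exact hw (c₁_z ▸ hXD)
    exact hwz' (hsolo w hyw ((c₁_of_ne w hwz').symm.trans ((hout w hw).symm.trans hwz)))
  refine ⟨Function.update c₂ y (c z), (hc₂.mono (G.deleteIncidenceSet_le y)).update hfree₂,
    fun i hi => ?_, fun v => ?_⟩
  · have h₁ := congrFun (classSize_update c z X) i
    have h₂ := congrFun hsize₂ i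
    have h₃ := congrFun (classSize_update c₂ y (c z)) i
    have h := congrFun hne i
    have hiy : i ≠ c y := fun h => hyA (h ▸ hi)
    have hib : i ≠ b := fun h => hb (h ▸ hi)
    simp only [Pi.add_apply, c₂_y, Pi.single_eq_of_ne hiy, Pi.single_eq_of_ne hib] at h h₁ h₂ h₃
    omega
  · obtain rfl | hvy := eq_or_ne v y
    · simp [hz]
    · simp [hvy, c₂_mem]

theorem IsProper.hasEquitableColoring_glue (hc : IsProper G c) (hsize : ∀ i ∈ A, classSize c i = s)
    (hP : ∀ v, c v ∉ A ↔ v ∈ P)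
    (hrec : HasEquitableColoring (G.induce (P : Set V)) {i // i ∉ A} s) :
    HasEquitableColoring G κ s := by
  obtain ⟨g, hg, hgsize⟩ := hrec
  have hP' : ∀ v, v ∉ P → c v ∈ A := fun v hv => not_not.1 (mt (hP v).1 hv)
  refine ⟨glue P g c, isProper_glue hc hg hP', fun i => ?_⟩
  by_cases hi : i ∈ A
  · rw [classSize_glue_of_mem (fun v => (hP v).2) hi, hsize i hi]
  · rw [classSize_glue_of_notMem hP' hi, hgsize]

/-- A vertex `y` for which `z` is solo takes the place of `z`, and the other vertices outside `A`
are recoloured equitably. Only the edges at `z` may then be badly coloured. -/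
theorem IsProper.exists_replace (hc : IsProper G c) (hne : NearlyEquitable c s a b)
    (ha : a ∈ A) (hb : b ∉ A) (hz : c z ∈ A) (hy : IsSolo G c A z y)
    (hP : ∀ v, v ∈ P ↔ c v ∉ A ∧ v ≠ y)
    (hrec : HasEquitableColoring (G.induce (P : Set V)) {i // i ∉ A} s) :
    ∃ c' : V → κ, IsProper (G.deleteIncidenceSet z) c' ∧ NearlyEquitable c' s a (c z) ∧
      c' y = c z ∧ (∀ v, c v ∈ A → c' v = c v) ∧ ∀ v, c v ∉ A → v ≠ y → c' v ∉ A := by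
  obtain ⟨g, hg, hgsize⟩ := hrec
  obtain ⟨hyA, -, hsolo⟩ := hy
  set c₁ := Function.update c y (c z)
  have hupd : classSize c₁ + Pi.single (c y) 1 = classSize c + Pi.single (c z) 1 :=
    classSize_update c y (c z)
  have c₁_y : c₁ y = c z := Function.update_self ..
  have c₁_of_ne : ∀ v, v ≠ y → c₁ v = c v := fun v hv => Function.update_of_ne hv _ _
  have hP₁ : ∀ v ∈ P, c₁ v ∉ A := by grind
  have hP₁' : ∀ v, v ∉ P → c₁ v ∈ A := by grind
  have hfree : IsFree (G.deleteIncidenceSet z) c y (c z) := fun w hyw hwz => by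
    obtain ⟨hyw, -, hne⟩ := G.deleteIncidenceSet_adj.1 hyw
    exact hne (hsolo w hyw hwz)
  have hproper₁ : IsProper (G.deleteIncidenceSet z) c₁ :=
    ((hc.mono (G.deleteIncidenceSet_le z)).mono
      (SimpleGraph.deleteIncidenceSet_le _ y)).update hfree
  refine ⟨glue P g c₁, isProper_glue hproper₁
    (hg.mono (SimpleGraph.comap_monotone _ (G.deleteIncidenceSet_le z))) hP₁', ?_, ?_, ?_, ?_⟩
  · funext i
    have hupd := congrFun hupd i
    have hne := congrFun hne i
    simp only [Pi.add_apply] at hupd hne ⊢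
    by_cases hi : i ∈ A
    · rw [classSize_glue_of_mem hP₁ hi]
      rw [Pi.single_eq_of_ne (ne_of_mem_of_not_mem hi hyA)] at hupd
      rw [Pi.single_eq_of_ne (ne_of_mem_of_not_mem hi hb)] at hne
      omega
    · rw [classSize_glue_of_notMem hP₁' hi, hgsize,
        Pi.single_eq_of_ne (ne_of_mem_of_not_mem ha hi).symm,
        Pi.single_eq_of_ne (ne_of_mem_of_not_mem hz hi).symm]
  · rw [glue_of_notMem (by simp [hP]), c₁_y]
  · intro v hv
    rw [glue_of_notMem (by simp [hP, hv]), c₁_of_ne v (by grind)]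
  · intro v hv hvy
    have hvP : v ∈ P := (hP v).2 ⟨hv, hvy⟩
    rw [glue_of_mem hvP]
    exact (g ⟨v, hvP⟩).2

theorem IsProper.exists_expel [Fintype κ] (hc : IsProper G c) (hne : NearlyEquitable c s a b)
    (ha : a ∈ A) (hb : b ∉ A) (hz : c z ∈ A) (hy : IsSolo G c A z y)
    (hdeg : outDeg G c A z ≤ #Aᶜ) (hP : ∀ v, v ∈ P ↔ c v ∉ A ∧ v ≠ y)
    (hrec : HasEquitableColoring (G.induce (P : Set V)) {i // i ∉ A} s) :
    ∃ (c' : V → κ) (b' : κ), IsProper G c' ∧ NearlyEquitable c' s a b' ∧ c' y = c z ∧ c' z ∉ A ∧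
      (∀ v, c v ∈ A → v ≠ z → c' v = c v) ∧ ∀ v, c v ∉ A → v ≠ y → c' v ∉ A := by
  obtain ⟨c₁, hproper, hne₁, hyz, hin, hout⟩ := hc.exists_replace hne ha hb hz hy hP hrec
  obtain ⟨hyA, hadj, -⟩ := hy
  have hy_mem : y ∈ ({w | G.Adj z w ∧ c w ∉ A} : Finset V) := by simp [hadj.symm, hyA]
  have hN : ∀ w, G.Adj z w → c₁ w ∈ Aᶜ → w ∈ ({w | G.Adj z w ∧ c w ∉ A} : Finset V).erase y := by
    grind [mem_compl]
  obtain ⟨Y, hY, hfree⟩ := exists_isFree hN ((card_erase_lt_of_mem hy_mem).trans_le hdeg)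
  refine ⟨Function.update c₁ z Y, Y, hproper.update hfree, ?_, ?_, ?_, ?_, ?_⟩
  · have hupd := classSize_update c₁ z Y
    rw [hin z hz] at hupd
    funext i
    have hupd := congrFun hupd i
    have hne₁ := congrFun hne₁ i
    simp only [Pi.add_apply] at hupd hne₁ ⊢
    omega
  · rw [Function.update_of_ne hadj.ne, hyz]
  · simpa using hY
  · intro v hv hvz
    rw [Function.update_of_ne hvz, hin v hv]
  · intro v hv hvy
    have hvz : v ≠ z := by grind
    rw [Function.update_of_ne hvz]
    exact hout v hv hvy

end Equitable

section Progress

variable {V κ : Type*} [Fintype κ] {G : SimpleGraph V} {c : V → κ} {A : Finset κ} {a b : κ}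
  {s : ℕ} {y z : V}

/-- After the exchange of `z` and `y`, every vertex of colour in `A` other than `z` keeps its moves
inside `A`, and `y'` can move to the class that `z` has left. -/
theorem accessible_ssubset_of_expel {c' : V → κ} {y' : V}
    (hA : accessible G c a = A)
    (hreach : ∀ i ∈ A.erase (c z), ReachIn (Moves G c) (A.erase (c z)) i a)
    (hza : c z ≠ a) (hz : c z ∈ A) (hmov : ¬IsMovable G c A z) (hyz : c' y = c z) (hz' : c' z ∉ A)
    (hin : ∀ v, c v ∈ A → v ≠ z → c' v = c v) (hout : ∀ v, c v ∉ A → v ≠ y → c' v ∉ A)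
    (hy' : IsSolo G c A z y') (hne : y' ≠ y) (hadj : ¬G.Adj y y') :
    accessible G c a ⊂ accessible G c' a := by
  have hback : ∀ {w}, c' w ∈ A → w ≠ y → c' w = c w ∧ w ≠ z := by
    intro w hw hwy
    have hwz : w ≠ z := by
      rintro rfl
      exact hz' hw
    exact ⟨hin w (by_contra fun h => hout w h hwy hw) hwz, hwz⟩
  have hmoves : ∀ i ∈ A, ∀ j ∈ A, j ≠ c z → Moves G c i j → Moves G c' i j := by
    rintro _ hi j hj hjz ⟨v, rfl, hfree⟩
    have hvz : v ≠ z := by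
      rintro rfl
      exact hmov ⟨j, hj, hjz, hfree⟩
    refine ⟨v, hin v hi hvz, fun w hvw hwj => ?_⟩
    obtain ⟨hwc, -⟩ := hback (hwj ▸ hj) (by rintro rfl; exact hjz (hwj.symm.trans hyz))
    exact hfree w hvw (hwc.symm.trans hwj)
  have herase : A.erase (c z) ⊆ accessible G c' a :=
    subset_accessible hreach fun i hi j hj =>
      hmoves i (mem_of_mem_erase hi) j (mem_of_mem_erase hj) (ne_of_mem_erase hj)
  have hz_acc : c z ∈ accessible G c' a := by
    obtain ⟨k, hk, hzk, -⟩ := (reachIn_accessible (hA ▸ hz)).exists_step hza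
    rw [hA] at hk
    exact mem_accessible_of_moves
      (hmoves _ hz k (mem_of_mem_erase hk) (ne_of_mem_erase hk) hzk) (herase hk)
  have hy'_acc : c' y' ∈ accessible G c' a := by
    refine mem_accessible_of_moves ⟨y', rfl, fun w hyw hwz => ?_⟩ hz_acc
    obtain ⟨hwc, hw⟩ := hback (hwz ▸ hz) (by rintro rfl; exact hadj hyw.symm)
    exact hw (hy'.2.2 w hyw (hwc.symm.trans hwz))
  have hsub : accessible G c a ⊆ accessible G c' a := fun i hi => by
    by_cases hiz : i = c z
    · exact hiz ▸ hz_acc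
    · exact herase (mem_erase.2 ⟨hiz, hA ▸ hi⟩)
  exact hsub.ssubset_of_mem_notMem hy'_acc (hA ▸ hout y' hy'.1 hne)

variable [Fintype V]

theorem NearlyEquitable.exists_mem_ne (hne : NearlyEquitable c s a b)
    (hdeg : ∀ v, G.degree v < Fintype.card κ) (hA : ∀ ⦃i j⦄, Moves G c i j → j ∈ A → i ∈ A)
    (ha : a ∈ A) (hb : b ∉ A) : ∃ x ∈ A, x ≠ a := by
  by_contra! hall
  have houtDeg : ∀ x, c x = a → outDeg G c A x ≤ #Aᶜ := fun x hx =>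
    outDeg_le_of_not_isMovable (hdeg x) (hx ▸ ha) fun ⟨X, hX, hXx, _⟩ =>
      hXx ((hall X hX).trans hx.symm)
  have hnbr : ∀ y, c y ∉ A → 1 ≤ #{x ∈ {x | c x = a} | G.Adj y x} := fun y hy => by
    obtain ⟨x, hyx, hx⟩ : ∃ x, G.Adj y x ∧ c x = a := by
      simpa [IsFree] using not_isFree_of_notMem hA hy ha
    exact card_pos.2 ⟨x, by simp [hx, hyx]⟩
  have hcount : #{y | c y ∉ A} ≤ classSize c a * #Aᶜ :=
    calc #{y | c y ∉ A} ≤ ∑ y with c y ∉ A, #{x ∈ {x | c x = a} | G.Adj y x} := by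
          simpa using card_nsmul_le_sum {y | c y ∉ A} _ 1 fun y hy => hnbr y (by simpa using hy)
      _ = ∑ x with c x = a, outDeg G c A x := by
          simpa using
            (sum_outDeg_mul (R := ℕ) (G := G) (c := c) (A := A) {x | c x = a} fun _ => 1).symm
      _ ≤ classSize c a * #Aᶜ :=
          sum_le_card_nsmul _ _ _ fun x hx => houtDeg x (by simpa using hx)
  have hcard := hne.card_filter_notMem ha hb
  have hsize : classSize c a + 1 = s := by
    simpa [ne_of_mem_of_not_mem ha hb] using congrFun hne a
  nlinarith

theorem IsProper.hasEquitableColoring_or_accessible_ssubset (hc : IsProper G c)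
    (hne : NearlyEquitable c s a b) (hdeg : ∀ v, G.degree v < Fintype.card κ)
    (hA : accessible G c a = A) (hb : b ∉ A)
    (hrec : ∀ y z (P : Finset V), G.Adj y z → (∀ v, v ∈ P ↔ c v ∉ A ∧ v ≠ y) → c y ∉ A →
      HasEquitableColoring (G.induce (P : Set V)) {i // i ∉ A} s) :
    HasEquitableColoring G κ s ∨ ∃ (c' : V → κ) (b' : κ), IsProper G c' ∧
      NearlyEquitable c' s a b' ∧ accessible G c a ⊂ accessible G c' a := by
  have ha : a ∈ A := hA ▸ mem_accessible_self G c a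
  have hclosed : ∀ ⦃i j⦄, Moves G c i j → j ∈ A → i ∈ A := fun i j hij hj =>
    hA ▸ mem_accessible_of_moves hij (hA ▸ hj)
  have hreach : ∀ i ∈ A, ReachIn (Moves G c) A i a := fun i hi =>
    hA ▸ reachIn_accessible (hA ▸ hi)
  obtain ⟨U, T, hTA, hTne, haT, hTreach, hT⟩ :=
    exists_terminal_block hreach ha (hne.exists_mem_ne hdeg hclosed ha hb)
  have hsize : ∀ W ∈ T, classSize c W = s := fun W hW =>
    hne.classSize_eq_of_ne (ne_of_mem_of_not_mem hW haT) (ne_of_mem_of_not_mem (hTA hW) hb)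
  obtain ⟨z, y, hzT, hsolo, h⟩ := exists_solo hdeg hclosed hTA hTne hT hsize
    ((Nat.lt_succ_self _).trans_eq (hne.card_filter_notMem ha hb).symm)
  have hz : c z ∈ A := hTA hzT
  let P : Finset V := {v | c v ∉ A ∧ v ≠ y}
  have hP : ∀ v, v ∈ P ↔ c v ∉ A ∧ v ≠ y := fun v => mem_filter_univ v
  have hrecP := hrec y z P hsolo.2.1 hP hsolo.1
  by_cases hmov : IsMovable G c A z
  · obtain ⟨X, hX, hXz, hfree⟩ := hmov
    obtain ⟨c', hc', hsize', hP'⟩ := hc.exists_absorb hne hb hz hsolo hX hXz hfree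
      (hTreach _ hzT X (mem_erase.2 ⟨hXz, hX⟩))
    exact .inl (hc'.hasEquitableColoring_glue hsize' (fun v => (hP' v).trans (hP v).symm) hrecP)
  · obtain ⟨y', hy', hy'y, hadj⟩ := h.resolve_left hmov
    obtain ⟨c', b', hc', hne', hyz, hz', hin, hout⟩ := hc.exists_expel hne ha hb hz hsolo
      (outDeg_le_of_not_isMovable (hdeg z) hz hmov) hP hrecP
    exact .inr ⟨c', b', hc', hne', accessible_ssubset_of_expel hA (hTreach _ hzT)
      (ne_of_mem_of_not_mem hzT haT) hz hmov hyz hz' hin hout hy' hy'y hadj⟩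

theorem IsProper.hasEquitableColoring_of_mem_accessible (hc : IsProper G c)
    (hne : NearlyEquitable c s a b) (hb : b ∈ accessible G c a) : HasEquitableColoring G κ s := by
  obtain ⟨c', hc', hsize, -, -⟩ := hc.exists_shift (r := Moves G c) (fun _ _ _ _ _ => id) hb
    (reachIn_accessible hb)
  refine ⟨c', hc', fun i => ?_⟩
  have hsize := congrFun hsize i
  have hne := congrFun hne i
  simp only [Pi.add_apply] at hsize hne
  omega

/-- The hypothesis `hrec` on proper induced subgraphs that miss an edge is what the induction on the
number of edges provides. -/
theorem IsProper.hasEquitableColoring_of_nearlyEquitable (hc : IsProper G c)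
    (hne : NearlyEquitable c s a b) (hdeg : ∀ v, G.degree v < Fintype.card κ)
    (hrec : ∀ (P : Finset V) (A : Finset κ), (∃ y z, G.Adj y z ∧ y ∉ P) → #P = #Aᶜ * s →
      (∀ v ∈ P, #{w ∈ P | G.Adj v w} < #Aᶜ) →
      HasEquitableColoring (G.induce (P : Set V)) {i // i ∉ A} s) :
    HasEquitableColoring G κ s := by
  induction hn : #(accessible G c a)ᶜ using Nat.strong_induction_on generalizing c b with
  | h n ih =>
    by_cases hb : b ∈ accessible G c a
    · exact hc.hasEquitableColoring_of_mem_accessible hne hb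
    have ha := mem_accessible_self G c a
    have hrec' : ∀ y z (P : Finset V), G.Adj y z → (∀ v, v ∈ P ↔ c v ∉ accessible G c a ∧ v ≠ y) →
        c y ∉ accessible G c a →
        HasEquitableColoring (G.induce (P : Set V)) {i // i ∉ accessible G c a} s := by
      intro y z P hyz hP hy
      refine hrec P _ ⟨y, z, hyz, by simp [hP]⟩ ?_ fun v hv => ?_
      · have hPy : P = ({v | c v ∉ accessible G c a} : Finset V).erase y := by
          ext v
          simp [hP, and_comm]
        rw [hPy, card_erase_of_mem (by simpa using hy), hne.card_filter_notMem ha hb,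
          Nat.add_sub_cancel]
      · refine lt_of_le_of_lt (card_le_card fun w hw => ?_)
          (outDeg_lt (hdeg v) (fun i j => mem_accessible_of_moves) ((hP v).1 hv).1)
        obtain ⟨hwP, hvw⟩ := mem_filter.1 hw
        simpa using ⟨hvw, ((hP w).1 hwP).1⟩
    obtain h | ⟨c', b', hc', hne', hlt⟩ :=
      hc.hasEquitableColoring_or_accessible_ssubset hne hdeg rfl hb hrec'
    · exact h
    · exact ih _ (hn ▸ card_lt_card (compl_ssubset_compl.2 hlt)) hc' hne' rfl

end Progress

section Main

variable {V : Type*} {G : SimpleGraph V}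

theorem deleteIncidenceSet_lt {y z : V} (hyz : G.Adj y z) : G.deleteIncidenceSet y < G :=
  (G.deleteIncidenceSet_le y).lt_of_ne fun h => (G.deleteIncidenceSet_adj.1 (h.symm ▸ hyz)).2.1 rfl

theorem degree_induce (G : SimpleGraph V) {P : Finset V} (v : (P : Set V))
    [Fintype ((G.induce (P : Set V)).neighborSet v)] :
    (G.induce (P : Set V)).degree v = #{w ∈ P | G.Adj v w} := by
  rw [← SimpleGraph.card_neighborFinset_eq_degree, ← card_map (.subtype _)]
  congr 1
  ext w
  simp [and_comm]

variable [Fintype V]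

theorem exists_classSize_eq {κ : Type*} [Fintype κ] {s : ℕ}
    (hV : Fintype.card V = Fintype.card κ * s) : ∃ c : V → κ, ∀ i, classSize c i = s := by
  let e : V ≃ κ × Fin s := Fintype.equivOfCardEq (by simpa using hV)
  refine ⟨fun v => (e v).1, fun i => ?_⟩
  have himage : ({v | (e v).1 = i} : Finset V) =
      (univ : Finset (Fin s)).map ((Function.Embedding.sectR i _).trans e.symm.toEmbedding) := by
    ext v
    simp only [mem_filter, mem_univ, true_and, mem_map, Function.Embedding.trans_apply,
      Function.Embedding.sectR_apply, Equiv.coe_toEmbedding, e.symm_apply_eq]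
    exact ⟨fun h => ⟨(e v).2, Prod.ext h.symm rfl⟩, fun ⟨k, hk⟩ => hk ▸ rfl⟩
  rw [classSize, himage, card_map, card_univ, Fintype.card_fin]

theorem card_edgeFinset_induce_lt {P : Finset V} {y z : V} (hyz : G.Adj y z) (hy : y ∉ P) :
    #(G.induce (P : Set V)).edgeFinset < #G.edgeFinset := by
  refine lt_of_eq_of_lt ?_ (card_lt_card (filter_ssubset (p := fun e => e.toFinset ⊆ P).2
    ⟨s(y, z), by simpa using hyz, fun h => hy (h (by simp))⟩))
  rw [G.card_filter_edgeFinset_toFinset_subset P]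

theorem hasEquitableColoring_of_degree_lt {κ : Type*} [Fintype κ] {s : ℕ}
    (hV : Fintype.card V = Fintype.card κ * s) (hdeg : ∀ v, G.degree v < Fintype.card κ) :
    HasEquitableColoring G κ s := by
  induction hn : #G.edgeFinset using Nat.strong_induction_on generalizing V κ with
  | h n ih =>
    subst hn
    by_cases hG : ∃ y z, G.Adj y z
    · obtain ⟨y, z, hyz⟩ := hG
      have hsubgraph : ∀ H < G, HasEquitableColoring H κ s := fun H hH =>
        ih _ (card_lt_card (SimpleGraph.edgeFinset_strict_mono hH)) hV
          (fun v => (SimpleGraph.degree_le_of_le hH.le).trans_lt (hdeg v)) rfl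
      obtain ⟨c, hc, hsize⟩ := hsubgraph _ (deleteIncidenceSet_lt hyz)
      obtain ⟨j, -, hfree⟩ : ∃ j ∈ univ, IsFree G c y j :=
        exists_isFree (N := G.neighborFinset y) (by simp) (by simpa using hdeg y)
      have hne : NearlyEquitable (Function.update c y j) s (c y) j := by
        rw [NearlyEquitable, classSize_update, funext hsize]
      refine (hc.update hfree).hasEquitableColoring_of_nearlyEquitable hne hdeg ?_
      rintro P A ⟨y', z', hadj, hy'⟩ hcard hPdeg
      have hκ : Fintype.card {i // i ∉ A} = #Aᶜ := by
        simp [Fintype.card_subtype_compl, card_compl]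
      refine ih _ (card_edgeFinset_induce_lt hadj hy') ?_ (fun v => ?_) rfl
      · rw [hκ, ← hcard]
        simp
      · rw [hκ, degree_induce]
        exact hPdeg v v.2
    · push Not at hG
      obtain ⟨c, hc⟩ := exists_classSize_eq hV
      exact ⟨c, fun v w hvw => absurd hvw (hG v w), hc⟩

end Main

end HajnalSzemeredi

namespace EdgeOrderedGraph

open Finset SimpleGraph
open scoped Classical

section Tilings

variable {U V W : Type*} {F : EdgeOrderedGraph W} {K : EdgeOrderedGraph U} {G : EdgeOrderedGraph V}
  {S S' : Set V}

/-- `S` is the union of the vertex sets of the copies in an `F`-tiling of `G`. -/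
def TilesSet (F : EdgeOrderedGraph W) (G : EdgeOrderedGraph V) (S : Set V) : Prop :=
  ∃ 𝒯 : Set G.graph.Subgraph, IsTiling F G 𝒯 ∧ ⋃ H ∈ 𝒯, H.verts = S

theorem hasPerfectTiling_iff : HasPerfectTiling F G ↔ TilesSet F G Set.univ := by
  simp [HasPerfectTiling, TilesSet, Set.eq_univ_iff_forall]

theorem TilesSet.iUnion {ι : Type*} {S : ι → Set V} (hS : ∀ i, TilesSet F G (S i))
    (hd : Pairwise (Function.onFun Disjoint S)) : TilesSet F G (⋃ i, S i) := by
  choose 𝒯 h𝒯 hv using hS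
  refine ⟨⋃ i, 𝒯 i, ⟨fun H hH => ?_, ?_⟩, ?_⟩
  · obtain ⟨i, hi⟩ := Set.mem_iUnion.1 hH
    exact (h𝒯 i).1 H hi
  · rw [← Set.biUnion_univ]
    refine Set.PairwiseDisjoint.biUnion ?_ fun i _ => (h𝒯 i).2
    simp only [Set.iSup_eq_iUnion, hv]
    exact hd.set_pairwise _
  · simp only [Set.biUnion_iUnion, hv]

theorem TilesSet.union (hS : TilesSet F G S) (hS' : TilesSet F G S') (hd : Disjoint S S') :
    TilesSet F G (S ∪ S') := by
  rw [Set.union_eq_iUnion]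
  exact .iUnion (Bool.forall_bool.2 ⟨hS', hS⟩) (pairwise_disjoint_on_bool.2 hd)

theorem IsCopy.tilesSet {H : G.graph.Subgraph} (hH : IsCopy F G H) : TilesSet F G H.verts :=
  ⟨{H}, ⟨by simpa using hH, Set.pairwiseDisjoint_singleton _ _⟩, by simp⟩

theorem IsCopy.ncard_verts [Fintype W] {H : G.graph.Subgraph} (hH : IsCopy F G H) :
    H.verts.ncard = Fintype.card W := by
  obtain ⟨φ, -, rfl⟩ := hH
  have hverts : φ.toSubgraph.verts = φ '' Set.univ := rfl
  rw [hverts, Set.ncard_image_of_injective (f := φ) _ φ.injective, Set.ncard_univ,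
    Nat.card_eq_fintype_card]

theorem IsCopy.map {ψ : Copy K.graph G.graph} (hψ : PreservesEdgeOrder K G ψ)
    {H : K.graph.Subgraph} (hH : IsCopy F K H) : IsCopy F G (H.map ψ.toHom) := by
  obtain ⟨φ, hφ, rfl⟩ := hH
  refine ⟨ψ.comp φ, fun e e' he => ?_, Subgraph.map_comp ..⟩
  have hcomp : ∀ e, (ψ.comp φ).toHom.mapEdgeSet e = ψ.toHom.mapEdgeSet (φ.toHom.mapEdgeSet e) :=
    fun e => Subtype.ext (Sym2.map_map (f := φ) (g := ψ) e.1).symm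
  rw [hcomp, hcomp]
  exact hψ _ _ (hφ e e' he)

theorem TilesSet.map {ψ : Copy K.graph G.graph} (hψ : PreservesEdgeOrder K G ψ) {S : Set U}
    (hS : TilesSet F K S) : TilesSet F G (ψ '' S) := by
  obtain ⟨𝒯, ⟨hcopy, hdisj⟩, rfl⟩ := hS
  refine ⟨(·.map ψ.toHom) '' 𝒯, ⟨?_, ?_⟩, ?_⟩
  · rintro _ ⟨H, hH, rfl⟩
    exact (hcopy H hH).map hψ
  · rintro _ ⟨H, hH, rfl⟩ _ ⟨H', hH', rfl⟩ hne
    exact Set.disjoint_image_of_injective ψ.injective (hdisj hH hH' fun h => hne (h ▸ rfl))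
  · simp only [Set.biUnion_image, Set.image_iUnion₂]
    rfl

/-- The edge-ordered graph on `U` induced by `G` along `f`. -/
noncomputable def comap (f : U ↪ V) (G : EdgeOrderedGraph V) : EdgeOrderedGraph U where
  graph := G.graph.comap f
  edgeOrder :=
    letI := G.edgeOrder
    LinearOrder.lift' (Embedding.comap f G.graph).mapEdgeSet
      (Embedding.comap f G.graph).mapEdgeSet.injective

theorem preservesEdgeOrder_comap (f : U ↪ V) (G : EdgeOrderedGraph V) :
    PreservesEdgeOrder (G.comap f) G (Embedding.comap f G.graph).toCopy :=
  fun _ _ he => he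

theorem tilesSet_of_isClique [Fintype W] {S : Finset V} (hS : G.graph.IsClique S)
    (hcard : #S ∈ tilingOrders F) : TilesSet F G S := by
  let f : Fin #S ↪ V := S.equivFin.symm.toEmbedding.trans (.subtype _)
  have htop : (G.comap f).graph = ⊤ := by
    ext i j
    refine ⟨fun h => h.ne, fun h => ?_⟩
    exact hS (S.equivFin.symm i).2 (S.equivFin.symm j).2 (f.injective.ne h)
  have hrange : f '' Set.univ = S := by
    rw [Set.image_univ, Function.Embedding.coe_trans, Equiv.coe_toEmbedding,
      Set.range_comp, S.equivFin.symm.range_eq_univ]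
    simp
  exact hrange ▸ (hasPerfectTiling_iff.1 (hcard.2.2 _ htop)).map (preservesEdgeOrder_comap f G)

end Tilings

section Greedy

variable {V W : Type*} {F : EdgeOrderedGraph W} {G : EdgeOrderedGraph V} {S : Finset V}
  {j k t : ℕ}

theorem exists_isClique_partition {H : SimpleGraph V} (hS : #S = k * t)
    (hdeg : ∀ v ∈ S, #{w ∈ S | Hᶜ.Adj v w} < k) :
    ∃ P : Fin k → Finset V, (∀ i, H.IsClique (P i) ∧ #(P i) = t) ∧
      Pairwise (Function.onFun Disjoint fun i => (P i : Set V)) ∧ ⋃ i, (P i : Set V) = S := by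
  obtain ⟨c, hc, hsize⟩ : HajnalSzemeredi.HasEquitableColoring
      (Hᶜ.induce (S : Set V)) (Fin k) t :=
    HajnalSzemeredi.hasEquitableColoring_of_degree_lt (by simpa using hS) fun v => by
      rw [HajnalSzemeredi.degree_induce, Fintype.card_fin]
      convert hdeg v v.2
  have mem_class : ∀ {i v}, v ∈ ({v | c v = i} : Finset (S : Set V)).map (.subtype _) ↔
      ∃ h : v ∈ S, c ⟨v, h⟩ = i := by
    simp
  refine ⟨fun i => ({v | c v = i} : Finset (S : Set V)).map (.subtype _),
    fun i => ⟨fun v hv w hw hvw => ?_, ?_⟩, fun i j hij => ?_, ?_⟩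
  · obtain ⟨hvS, hv⟩ := mem_class.1 hv
    obtain ⟨hwS, hw⟩ := mem_class.1 hw
    by_contra h
    exact hc (v := ⟨v, hvS⟩) (w := ⟨w, hwS⟩) ((compl_adj ..).2 ⟨hvw, h⟩) (hv.trans hw.symm)
  · rw [card_map, ← hsize i, HajnalSzemeredi.classSize]
    congr!
  · refine disjoint_coe.2 (disjoint_left.2 fun v hv hw => hij ?_)
    obtain ⟨hvS, hv⟩ := mem_class.1 hv
    obtain ⟨_, hw⟩ := mem_class.1 hw
    exact hv.symm.trans hw
  · ext v
    simp only [Set.mem_iUnion, mem_coe, mem_class, exists_comm (α := Fin k), exists_eq',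
      exists_prop, and_true]

variable [Fintype W]

theorem exists_isCopy_subset (ht : t ∈ tilingOrders F) (hk : 0 < k) (hS : k * t ≤ #S)
    (hdeg : ∀ v ∈ S, #{w ∈ S | G.graphᶜ.Adj v w} < k) :
    ∃ H : G.graph.Subgraph, IsCopy F G H ∧ H.verts ⊆ S := by
  obtain ⟨S', hS', hcard⟩ := exists_subset_card_eq hS
  obtain ⟨P, hP, -, hPS⟩ := exists_isClique_partition hcard fun v hv =>
    (card_le_card (filter_subset_filter _ hS')).trans_lt (hdeg v (hS' hv))
  obtain ⟨hclique, hcard₀⟩ := hP ⟨0, hk⟩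
  obtain ⟨𝒯, h𝒯, hverts⟩ := tilesSet_of_isClique (F := F) hclique (hcard₀ ▸ ht)
  obtain ⟨u, hu⟩ : (P ⟨0, hk⟩).Nonempty := card_pos.1 (hcard₀ ▸ ht.1)
  obtain ⟨H, hH, -⟩ := Set.mem_iUnion₂.1 (hverts.symm.subset (mem_coe.2 hu))
  refine ⟨H, h𝒯.1 H hH, ?_⟩
  calc H.verts ⊆ ⋃ H ∈ 𝒯, H.verts := Set.subset_biUnion_of_mem hH
    _ = P ⟨0, hk⟩ := hverts
    _ ⊆ ⋃ i, (P i : Set V) := Set.subset_iUnion (fun i => (P i : Set V)) _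
    _ = S' := hPS
    _ ⊆ S := coe_subset.2 hS'

theorem tilesSet_of_card (ht : t ∈ tilingOrders F) (hk : 0 < k)
    (hS : #S = k * t + j * Fintype.card W)
    (hdeg : ∀ v ∈ S, #{w ∈ S | G.graphᶜ.Adj v w} < k) : TilesSet F G S := by
  induction j generalizing S with
  | zero =>
    obtain ⟨P, hP, hdisj, hPS⟩ := exists_isClique_partition (by simpa using hS) hdeg
    exact hPS ▸ .iUnion (fun i => tilesSet_of_isClique (hP i).1 ((hP i).2 ▸ ht)) hdisj
  | succ j ih =>
    obtain ⟨H, hH, hHS⟩ := exists_isCopy_subset (F := F) ht hk (by omega) hdeg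
    lift H.verts to Finset V using S.finite_toSet.subset hHS with X hX
    have hXS : X ⊆ S := coe_subset.1 hHS
    have hXcard : #X = Fintype.card W := by
      rw [← hH.ncard_verts, ← hX, Set.ncard_coe_finset]
    have hrest : TilesSet F G (S \ X : Finset V) :=
      ih (by rw [card_sdiff_of_subset hXS, hS, hXcard, Nat.succ_mul]; omega) fun v hv =>
        (card_le_card (filter_subset_filter _ sdiff_subset)).trans_lt
          (hdeg v (mem_sdiff.1 hv).1)
    have hunion := (hX ▸ hH.tilesSet).union hrest (disjoint_coe.2 disjoint_sdiff)
    rwa [← coe_union, union_sdiff_of_subset hXS] at hunion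

end Greedy

theorem degree_compl_lt_of_minDegree {V : Type*} [Fintype V] {H : SimpleGraph V}
    [DecidableRel H.Adj] {t : ℕ} (ht : 0 < t)
    (hH : (1 - 1 / (t : ℝ)) * (Fintype.card V : ℝ) ≤ (H.minDegree : ℝ)) (v : V) :
    #{w | Hᶜ.Adj v w} < Fintype.card V / t := by
  have hdeg : (H.minDegree : ℝ) ≤ H.degree v := mod_cast H.minDegree_le_degree v
  have hcompl : #{w | Hᶜ.Adj v w} + 1 + H.degree v = Fintype.card V := by
    have hlt := H.degree_lt_card_verts v
    have hcompl := H.degree_compl v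
    rw [← card_neighborFinset_eq_degree, neighborFinset_eq_filter] at hcompl
    convert (by omega : #{w | Hᶜ.Adj v w} + 1 + H.degree v = Fintype.card V)
  rw [← Nat.succ_le_iff, Nat.le_div_iff_mul_le ht, ← Nat.cast_le (α := ℝ), Nat.cast_mul,
    ← le_div_iff₀ (Nat.cast_pos.2 ht)]
  have hsum : ((#{w | Hᶜ.Adj v w}).succ : ℝ) + H.degree v = Fintype.card V := mod_cast hcompl
  have hexpand : (1 - 1 / (t : ℝ)) * Fintype.card V = Fintype.card V - Fintype.card V / t := by ring
  linarith

end EdgeOrderedGraph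

theorem theorem1p6 {W : Type*} [Fintype W] [Nonempty W] (F : EdgeOrderedGraph W)
    (hF : F.Tileable) (n : ℕ) (hn : F.tilingNumber ≤ n) (hdvd : Fintype.card W ∣ n)
    {V : Type*} [Fintype V] (hV : Fintype.card V = n) (G : EdgeOrderedGraph V)
    [DecidableRel G.graph.Adj]
    (hG : (1 - 1 / (F.tilingNumber : ℝ)) * (n : ℝ) ≤ (G.graph.minDegree : ℝ)) :
    EdgeOrderedGraph.HasPerfectTiling F G := by
  classical
  subst hV
  have ht : F.tilingNumber ∈ F.tilingOrders := Nat.sInf_mem hF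
  have hk : 0 < Fintype.card V / F.tilingNumber := Nat.div_pos hn ht.1
  obtain ⟨j, hj⟩ : Fintype.card W ∣ Fintype.card V % F.tilingNumber :=
    (Nat.dvd_mod_iff ht.2.1).2 hdvd
  have hcard : (Finset.univ : Finset V).card =
      Fintype.card V / F.tilingNumber * F.tilingNumber + j * Fintype.card W := by
    rw [mul_comm j, ← hj, Nat.div_add_mod', Finset.card_univ]
  have htiles : EdgeOrderedGraph.TilesSet F G (Finset.univ : Finset V) :=
    EdgeOrderedGraph.tilesSet_of_card ht hk hcard fun v _ => by
      convert EdgeOrderedGraph.degree_compl_lt_of_minDegree ht.1 hG v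
  exact EdgeOrderedGraph.hasPerfectTiling_iff.2 (by simpa using htiles)
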